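/- Let $N$ be a positive integer, let $\mathbb D=\{z\in\mathbb C:|z|<1\}$, and let $M_N(\mathbb C)$ be the algebra of complex $N\times N$ matrices with the operator norm $\|\cdot\|$ induced by the Euclidean norm of $\mathbb C^N$. A function $\Phi:\mathbb D\to M_N(\mathbb C)$ is called rational if every entry of $\Phi$ is a rational function with no poles in $\mathbb D$, and inner if it is holomorphic with $\|\Phi(z)\|\le 1$ for all $z\in\mathbb D$ and, for almost every point $\zeta$ of the unit circle, the radial limit $\lim_{r\to1^-}\Phi(r\zeta)$ exists and is a unitary matrix. Let $F:\mathbb D\to M_N(\mathbb C)$ be holomorphic with $\|F(z)\|\le 1$ for all $z\in\mathbb D$. Then there is a sequence $(\Phi_m)$ of $M_N(\mathbb C)$-valued rational inner functions on $\mathbb D$ that converges to $F$ uniformly on every compact subset of $\mathbb D$. -/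

import Mathlib

open Filter Topology Polynomial
-- `M_N(ℂ)` carries the operator norm coming from the Euclidean norm of `ℂ^N`
open scoped Matrix.Norms.L2Operator

/-- A matrix-valued function on the open unit disc is rational if every entry is a rational
function with its poles off the disc. Only the values of `F` on the disc matter. -/
def IsRationalOnDisc {N : ℕ} (F : ℂ → Matrix (Fin N) (Fin N) ℂ) : Prop :=
  ∀ i j, ∃ p q : ℂ[X], ∀ z ∈ Metric.ball (0 : ℂ) 1,
    q.eval z ≠ 0 ∧ F z i j = p.eval z / q.eval z

/-- A matrix-valued inner function on the open unit disc: holomorphic, contractive, and with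
unitary radial boundary values at almost every point of the unit circle. Only the values of `F`
on the disc matter. -/
structure IsInnerOnDisc {N : ℕ} (F : ℂ → Matrix (Fin N) (Fin N) ℂ) : Prop where
  holomorphic : DifferentiableOn ℂ F (Metric.ball 0 1)
  contractive : ∀ z ∈ Metric.ball (0 : ℂ) 1, ‖F z‖ ≤ 1
  boundary : ∀ᵐ θ : ℝ, ∃ U ∈ Matrix.unitaryGroup (Fin N) ℂ,
    Tendsto (fun r : ℝ => F (r * Complex.exp (θ * Complex.I))) (𝓝[<] 1) (𝓝 U)

/-!
A Schur algorithm for matrix-valued functions. A block matrix `(a b; c d)` that is unitary for the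
indefinite form `diag(1, -1)` acts on matrices by the fractional linear map
`W ↦ (a W + b) (c W + d)⁻¹`. This map sends contractions to contractions and unitaries to
unitaries, and every strict contraction `A` is the image of `0` under such a map
(`exists_isJUnitary`).

Let `F` satisfy `‖F‖ ≤ r < 1` on the disc. Applying the inverse of the map that sends `0` to `F 0`
produces a function `G` with `G 0 = 0` and `‖G‖ ≤ s < 1`; by the Schwarz lemma `G z = z • F₁ z`,
where `F₁` again has `‖F₁‖ ≤ s`. If `Φ₁` is rational inner and `F₁ - Φ₁` is divisible by `z ^ n`,
then the image `Φ` of `z • Φ₁ z` under the original map is rational inner and `F - Φ` is divisible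
by `z ^ (n + 1)`. Starting from the constant inner function `1`, induction gives rational inner
functions that agree with `F` at the origin to any prescribed order
(`exists_rational_inner_sub_eq_pow_smul`).

Two contractive functions that agree to order `n` differ by at most `2 |z| ^ n`, by the Schwarz
lemma once more. Applying the construction to `(1 - ε) F` and letting `ε → 0` and `n → ∞` together
gives locally uniform convergence to any contractive `F`.
-/

/-! ### Contractions in the matrix order -/

section

open scoped MatrixOrder ComplexOrder

theorem norm_le_iff_star_mul_self_le {N : ℕ} (A : Matrix (Fin N) (Fin N) ℂ) {r : ℝ} (hr : 0 ≤ r) :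
    ‖A‖ ≤ r ↔ star A * A ≤ algebraMap ℝ _ (r ^ 2) := by
  rw [← CStarAlgebra.norm_le_iff_le_algebraMap _ (by positivity) (star_mul_self_nonneg A),
    CStarRing.norm_star_mul_self, ← sq, sq_le_sq₀ (norm_nonneg A) hr]

/-- If `P` dominates `Q` in the sense that `‖Q x‖ ≤ ‖P x‖`, then a vector killed by `P` is killed by
`Q`, hence is zero as soon as `P` and `Q` have no common kernel. -/
theorem isUnit_of_star_mul_self_le {N : ℕ} {P Q S T : Matrix (Fin N) (Fin N) ℂ}
    (hle : star Q * Q ≤ star P * P) (h : S * P + T * Q = 1) : IsUnit P := by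
  rw [← Matrix.mulVec_injective_iff_isUnit]
  refine (injective_iff_map_eq_zero P.mulVecLin).mpr fun x hx => ?_
  rw [Matrix.mulVecLin_apply] at hx
  have h0 := (Matrix.le_iff.mp hle).dotProduct_mulVec_nonneg x
  have hQ : Q.mulVec x = 0 := by
    rw [Matrix.sub_mulVec, ← Matrix.mulVec_mulVec, hx, Matrix.mulVec_zero, zero_sub,
      dotProduct_neg, Left.nonneg_neg_iff] at h0
    rw [← dotProduct_star_self_eq_zero]
    refine le_antisymm ?_ (dotProduct_star_self_nonneg _)
    rwa [Matrix.star_mulVec, ← Matrix.dotProduct_mulVec, Matrix.mulVec_mulVec,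
      ← Matrix.star_eq_conjTranspose]
  rw [← Matrix.one_mulVec x, ← h, Matrix.add_mulVec, ← Matrix.mulVec_mulVec,
    ← Matrix.mulVec_mulVec, hx, hQ]
  simp

/-! ### Fractional linear maps of matrices -/

/-- The fractional linear map `W ↦ (a W + b) (c W + d)⁻¹`. The inverse is Mathlib's matrix inverse,
so the value is meaningful only where `c W + d` is invertible. -/
noncomputable def mobius {N : ℕ} (a b c d W : Matrix (Fin N) (Fin N) ℂ) :
    Matrix (Fin N) (Fin N) ℂ :=
  (a * W + b) * (c * W + d)⁻¹

/-- The block matrix `U = (a b; c d)` is unitary for the indefinite form `J = diag(1, -1)`. The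
fields are the block entries of `U* J U = J` followed by those of the equivalent `U J U* = J`, the
second off-diagonal entry of each being the adjoint of the one listed. -/
structure IsJUnitary {N : ℕ} (a b c d : Matrix (Fin N) (Fin N) ℂ) : Prop where
  aa : star a * a - star c * c = 1
  dd : star d * d - star b * b = 1
  ab : star a * b = star c * d
  aa' : a * star a - b * star b = 1
  dd' : d * star d - c * star c = 1
  ac' : a * star c = b * star d

/-- The inverse square root of `1 - B* B`, up to a unitary factor. -/
theorem exists_star_mul_one_sub_mul_eq_one {N : ℕ} {B : Matrix (Fin N) (Fin N) ℂ}
    (hB : ‖B‖ < 1) :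
    ∃ d, star d * (1 - star B * B) * d = 1 := by
  have hpos : 0 ≤ 1 - star B * B := by
    simpa using (norm_le_iff_star_mul_self_le B zero_le_one).mp hB.le
  have hunit : IsUnit (1 - star B * B) := by
    refine isUnit_one_sub_of_norm_lt_one ?_
    rw [CStarRing.norm_star_mul_self]
    nlinarith [norm_nonneg B]
  obtain ⟨e, he⟩ := CStarAlgebra.nonneg_iff_eq_star_mul_self.mp hpos
  rw [he, Matrix.isUnit_iff_isUnit_det, Matrix.det_mul] at hunit
  have h1 : e * e⁻¹ = 1 := Matrix.mul_nonsing_inv _ (isUnit_of_mul_isUnit_right hunit)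
  refine ⟨e⁻¹, ?_⟩
  rw [he, mul_assoc, mul_assoc, h1, mul_one, ← star_mul, h1, star_one]

/-- Every strict contraction `A` is the value at `0` of the map of some `J`-unitary matrix. This is
expressed by the vanishing at `A` of the numerator `a* W - c*` of the inverse map. -/
theorem exists_isJUnitary {N : ℕ} {A : Matrix (Fin N) (Fin N) ℂ} (hA : ‖A‖ < 1) :
    ∃ a b c d, IsJUnitary a b c d ∧ star a * A = star c := by
  obtain ⟨d, hd⟩ := exists_star_mul_one_sub_mul_eq_one hA
  obtain ⟨a, ha⟩ := exists_star_mul_one_sub_mul_eq_one (B := star A) (by rwa [norm_star])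
  rw [star_star] at ha
  have h1 : star a * a - star (star A * a) * (star A * a) = 1 := by
    rw [← ha, star_mul, star_star]; noncomm_ring
  have h2 : star d * d - star (A * d) * (A * d) = 1 := by
    rw [← hd, star_mul]; noncomm_ring
  have h3 : star a * (A * d) = star (star A * a) * d := by
    rw [star_mul, star_star, mul_assoc]
  have h4 : star (A * d) * a = star d * (star A * a) := by
    rw [star_mul, mul_assoc]
  -- A one-sided inverse of a square block matrix is two-sided, which gives `U J U* = J`.
  have h := mul_eq_one_comm.mp <| show
    Matrix.fromBlocks (star a) (-star (star A * a)) (-star (A * d)) (star d) *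
      Matrix.fromBlocks a (A * d) (star A * a) d = 1 by
    rw [Matrix.fromBlocks_multiply, ← Matrix.fromBlocks_one]
    congr 1
    · rw [← h1, neg_mul, sub_eq_add_neg]
    · rw [h3, neg_mul, add_neg_cancel]
    · rw [neg_mul, h4, neg_add_cancel]
    · rw [← h2, neg_mul, sub_eq_add_neg, add_comm]
  rw [Matrix.fromBlocks_multiply, ← Matrix.fromBlocks_one, Matrix.fromBlocks_inj] at h
  obtain ⟨e1, e2, -, e4⟩ := h
  refine ⟨a, A * d, star A * a, d, ⟨h1, h2, h3, ?_, ?_, ?_⟩, by simp⟩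
  · rw [← e1, mul_neg, sub_eq_add_neg]
  · rw [← e4, mul_neg, sub_eq_add_neg, add_comm]
  · rwa [mul_neg, neg_add_eq_zero] at e2

namespace IsJUnitary

variable {N : ℕ} {a b c d : Matrix (Fin N) (Fin N) ℂ} (h : IsJUnitary a b c d)
include h

/-- Invariance of the indefinite form, evaluated at the block column `(W, 1)`. -/
theorem star_mul_self_sub (W : Matrix (Fin N) (Fin N) ℂ) :
    star (c * W + d) * (c * W + d) - star (a * W + b) * (a * W + b) = 1 - star W * W := by
  have hba : star b * a = star d * c := by simpa using congrArg star h.ab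
  calc _ = star W * (-(star a * a - star c * c)) * W + (star d * d - star b * b)
        - star W * (star a * b - star c * d) - (star b * a - star d * c) * W := by
          simp only [star_add, star_mul]; noncomm_ring
    _ = _ := by rw [h.aa, h.dd, h.ab, hba]; noncomm_ring

/-- The inverse `J U* J` of a `J`-unitary `U` is `J`-unitary. -/
theorem symm : IsJUnitary (star a) (-star c) (-star b) (star d) where
  aa := by simpa using h.aa'
  dd := by simpa using h.dd'
  ab := by simpa using h.ac'
  aa' := by simpa using h.aa
  dd' := by simpa using h.dd
  ac' := by simpa using h.ab

theorem isUnit {W : Matrix (Fin N) (Fin N) ℂ} (hW : ‖W‖ ≤ 1) : IsUnit (c * W + d) := by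
  have hba : star b * a = star d * c := by simpa using congrArg star h.ab
  refine isUnit_of_star_mul_self_le (Q := a * W + b) (S := star d) (T := -star b) ?_ ?_
  · rw [← sub_nonneg, h.star_mul_self_sub, sub_nonneg]
    simpa using (norm_le_iff_star_mul_self_le W zero_le_one).mp hW
  · calc _ = (star d * c - star b * a) * W + (star d * d - star b * b) := by noncomm_ring
      _ = 1 := by rw [hba, h.dd]; simp

theorem one_sub_star_mul_self {W : Matrix (Fin N) (Fin N) ℂ} (hW : ‖W‖ ≤ 1) :
    1 - star (mobius a b c d W) * (mobius a b c d W) =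
      star (c * W + d)⁻¹ * (1 - star W * W) * (c * W + d)⁻¹ := by
  have hu := (Matrix.isUnit_iff_isUnit_det _).mp (h.isUnit hW)
  have h1 : (c * W + d) * (c * W + d)⁻¹ = 1 := Matrix.mul_nonsing_inv _ hu
  have h2 : star (c * W + d)⁻¹ * star (c * W + d) = 1 := by rw [← star_mul, h1, star_one]
  rw [mobius, ← h.star_mul_self_sub W, star_mul]
  set P := c * W + d
  set Q := a * W + b
  calc _ = (star P⁻¹ * star P) * (P * P⁻¹) - star P⁻¹ * star Q * (Q * P⁻¹) := by
        rw [h1, h2, one_mul]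
    _ = _ := by noncomm_ring

theorem norm_mobius_le_one {W : Matrix (Fin N) (Fin N) ℂ} (hW : ‖W‖ ≤ 1) :
    ‖mobius a b c d W‖ ≤ 1 := by
  rw [norm_le_iff_star_mul_self_le _ zero_le_one, one_pow, map_one, ← sub_nonneg,
    h.one_sub_star_mul_self hW]
  refine star_left_conjugate_nonneg ?_ _
  simpa using (norm_le_iff_star_mul_self_le W zero_le_one).mp hW

/-- A ball of radius less than `1` is mapped into a ball of radius less than `1`. Writing
`P = c W + d` and `Z` for the image of `W`, one has `1 - Z* Z = P⁻¹* (1 - W* W) P⁻¹`, which is at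
least `(1 - r²) / k²` when `‖W‖ ≤ r` and `‖P‖ ≤ k`. -/
theorem exists_norm_mobius_le {r : ℝ} (hr0 : 0 ≤ r) (hr : r < 1) :
    ∃ s, 0 ≤ s ∧ s < 1 ∧ ∀ W : Matrix (Fin N) (Fin N) ℂ, ‖W‖ ≤ r →
      ‖mobius a b c d W‖ ≤ s := by
  -- The summand `1` makes `k ≥ 1`, so that the radicand below is nonnegative.
  set k := ‖c‖ + ‖d‖ + 1
  have hk1 : 1 ≤ k := by have := norm_nonneg c; have := norm_nonneg d; linarith
  have hr2 : 0 < 1 - r ^ 2 := by nlinarith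
  have hkp : 0 < (1 - r ^ 2) / k ^ 2 := by positivity
  have hk2 : (1 - r ^ 2) / k ^ 2 ≤ 1 := by
    rw [div_le_one (by positivity)]; nlinarith [sq_nonneg r]
  refine ⟨√(1 - (1 - r ^ 2) / k ^ 2), by positivity, ?_, fun W hW => ?_⟩
  · rw [Real.sqrt_lt' one_pos]; linarith
  have hW1 : ‖W‖ ≤ 1 := hW.trans hr.le
  rw [norm_le_iff_star_mul_self_le _ (by positivity), Real.sq_sqrt (by linarith)]
  have hP : ‖c * W + d‖ ≤ k := by
    calc _ ≤ ‖c‖ * ‖W‖ + ‖d‖ := (norm_add_le _ _).trans (by gcongr; exact norm_mul_le _ _)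
      _ ≤ ‖c‖ * 1 + ‖d‖ := by gcongr
      _ ≤ k := by linarith
  have hP' := (norm_le_iff_star_mul_self_le _ (by positivity)).mp hP
  have hu := (Matrix.isUnit_iff_isUnit_det _).mp (h.isUnit hW1)
  have h1 : (c * W + d) * (c * W + d)⁻¹ = 1 := Matrix.mul_nonsing_inv _ hu
  have h2 : star (c * W + d)⁻¹ * star (c * W + d) = 1 := by rw [← star_mul, h1, star_one]
  have hle : algebraMap ℝ _ ((1 - r ^ 2) / k ^ 2) * (star (c * W + d) * (c * W + d)) ≤
      1 - star W * W := by
    calc _ ≤ algebraMap ℝ (Matrix (Fin N) (Fin N) ℂ) (1 - r ^ 2) := by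
          have := smul_le_smul_of_nonneg_left hP' hkp.le
          rwa [Algebra.smul_def, Algebra.smul_def, ← map_mul,
            div_mul_cancel₀ _ (by positivity)] at this
      _ ≤ _ := by
        rw [map_sub, map_one]
        exact sub_le_sub_left ((norm_le_iff_star_mul_self_le W hr0).mp hW) 1
  have hcon := star_left_conjugate_le_conjugate hle (c * W + d)⁻¹
  rw [← h.one_sub_star_mul_self hW1] at hcon
  have e : star (c * W + d)⁻¹ * (algebraMap ℝ _ ((1 - r ^ 2) / k ^ 2) *
      (star (c * W + d) * (c * W + d))) * (c * W + d)⁻¹ =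
      algebraMap ℝ _ ((1 - r ^ 2) / k ^ 2) := by
    rw [← mul_assoc, ← Algebra.commutes, mul_assoc, mul_assoc, mul_assoc, h1, mul_one, h2, mul_one]
  rw [e] at hcon
  rw [map_sub, map_one]
  exact le_sub_comm.mp hcon

theorem mobius_mem_unitaryGroup {W : Matrix (Fin N) (Fin N) ℂ} (hW1 : ‖W‖ ≤ 1) (hW : star W * W = 1) :
    mobius a b c d W ∈ Matrix.unitaryGroup (Fin N) ℂ := by
  rw [Matrix.mem_unitaryGroup_iff']
  have := h.one_sub_star_mul_self hW1
  rw [hW, sub_self, mul_zero, zero_mul, sub_eq_zero] at this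
  exact this.symm

/-- A difference formula in which `X - Y` appears as a factor: it transports divisibility of `X - Y`
by a power of `z` to the images. -/
theorem mobius_sub_mobius {X Y : Matrix (Fin N) (Fin N) ℂ} (hX : ‖X‖ ≤ 1) (hY : ‖Y‖ ≤ 1) :
    mobius a b c d X - mobius a b c d Y =
      (a - mobius a b c d Y * c) * (X - Y) * (c * X + d)⁻¹ := by
  have h1 := Matrix.mul_nonsing_inv _ ((Matrix.isUnit_iff_isUnit_det _).mp (h.isUnit hX))
  have h2 := Matrix.nonsing_inv_mul _ ((Matrix.isUnit_iff_isUnit_det _).mp (h.isUnit hY))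
  set P := c * X + d with hP
  set Q := c * Y + d with hQ
  have e : c * (X - Y) = P - Q := by rw [hP, hQ]; noncomm_ring
  have e' : a * (X - Y) = (a * X + b) - (a * Y + b) := by noncomm_ring
  symm
  calc _ = (a * (X - Y) - mobius a b c d Y * (c * (X - Y))) * P⁻¹ := by noncomm_ring
    _ = (a * X + b) * P⁻¹ - (a * Y + b) * P⁻¹ - (a * Y + b) * Q⁻¹ * (P * P⁻¹)
        + (a * Y + b) * (Q⁻¹ * Q) * P⁻¹ := by rw [e, e', mobius]; noncomm_ring
    _ = _ := by rw [h1, h2, mobius, mobius]; noncomm_ring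

theorem mobius_mobius_symm {W : Matrix (Fin N) (Fin N) ℂ} (hW : ‖W‖ ≤ 1) :
    mobius a b c d (mobius (star a) (-star c) (-star b) (star d) W) = W := by
  have h1 := Matrix.mul_nonsing_inv _ ((Matrix.isUnit_iff_isUnit_det _).mp (h.symm.isUnit hW))
  have hca : c * star a = d * star b := by simpa using congrArg star h.ac'
  set V := -star b * W + star d with hV
  have e1 : a * (star a * W + -star c) + b * V = W := by
    calc _ = (a * star a - b * star b) * W + (b * star d - a * star c) := by
          rw [hV]; noncomm_ring
      _ = W := by rw [h.aa', h.ac']; simp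
  have e2 : c * (star a * W + -star c) + d * V = 1 := by
    calc _ = (c * star a - d * star b) * W + (d * star d - c * star c) := by
          rw [hV]; noncomm_ring
      _ = 1 := by rw [h.dd', hca]; simp
  have f1 : a * ((star a * W + -star c) * V⁻¹) + b = W * V⁻¹ := by
    rw [← mul_one b, ← h1, ← mul_assoc, ← mul_assoc, ← add_mul, e1]
  have f2 : c * ((star a * W + -star c) * V⁻¹) + d = V⁻¹ := by
    rw [← mul_one d, ← h1, ← mul_assoc, ← mul_assoc, ← add_mul, e2, one_mul]
  rw [mobius, mobius, f1, f2, Matrix.nonsing_inv_nonsing_inv, mul_assoc,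
    Matrix.nonsing_inv_mul, mul_one]
  all_goals exact ((Matrix.isUnit_iff_isUnit_det _).mp (h.symm.isUnit hW))

end IsJUnitary

end

/-! ### Rational functions without poles in the disc -/

/-- The ring of scalar functions that agree on the open unit disc with a rational function without
poles there. Values off the disc are arbitrary. -/
def rationalOnDisc : Subring (ℂ → ℂ) where
  carrier := {f | ∃ p q : ℂ[X], ∀ z ∈ Metric.ball (0 : ℂ) 1,
    q.eval z ≠ 0 ∧ f z = p.eval z / q.eval z}
  mul_mem' := by
    rintro f g ⟨p, q, h⟩ ⟨p', q', h'⟩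
    refine ⟨p * p', q * q', fun z hz => ⟨?_, ?_⟩⟩
    · simpa using ⟨(h z hz).1, (h' z hz).1⟩
    · simp [(h z hz).2, (h' z hz).2, div_mul_div_comm]
  one_mem' := ⟨1, 1, fun z _ => by simp⟩
  add_mem' := by
    rintro f g ⟨p, q, h⟩ ⟨p', q', h'⟩
    refine ⟨p * q' + q * p', q * q', fun z hz => ⟨?_, ?_⟩⟩
    · simpa using ⟨(h z hz).1, (h' z hz).1⟩
    · simp [(h z hz).2, (h' z hz).2, div_add_div _ _ (h z hz).1 (h' z hz).1]
  zero_mem' := ⟨0, 1, fun z _ => by simp⟩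
  neg_mem' := by
    rintro f ⟨p, q, h⟩
    exact ⟨-p, q, fun z hz => ⟨(h z hz).1, by simp [(h z hz).2, neg_div]⟩⟩

theorem eval_mem_rationalOnDisc (p : ℂ[X]) : (fun z => p.eval z) ∈ rationalOnDisc :=
  ⟨p, 1, fun z _ => by simp⟩

theorem inv_mem_rationalOnDisc {f : ℂ → ℂ} (hf : f ∈ rationalOnDisc)
    (h0 : ∀ z ∈ Metric.ball (0 : ℂ) 1, f z ≠ 0) : (fun z => (f z)⁻¹) ∈ rationalOnDisc := by
  obtain ⟨p, q, h⟩ := hf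
  refine ⟨q, p, fun z hz => ⟨fun hp => h0 z hz ?_, ?_⟩⟩
  · rw [(h z hz).2, hp, zero_div]
  · simp only [(h z hz).2, inv_div]

theorem det_mem_rationalOnDisc {N : ℕ} {F : ℂ → Matrix (Fin N) (Fin N) ℂ}
    (hF : IsRationalOnDisc F) : (fun z => (F z).det) ∈ rationalOnDisc := by
  have : (fun z => (F z).det) =
      ∑ σ : Equiv.Perm (Fin N), (Equiv.Perm.sign σ : ℤ) • ∏ i, fun z => F z (σ i) i := by
    ext z
    simp [Matrix.det_apply, Units.smul_def]
  rw [this]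
  exact sum_mem fun σ _ => zsmul_mem (prod_mem fun i _ => hF _ _) _

namespace IsRationalOnDisc

variable {N : ℕ} {F G : ℂ → Matrix (Fin N) (Fin N) ℂ}

theorem const (A : Matrix (Fin N) (Fin N) ℂ) : IsRationalOnDisc fun _ => A := fun i j =>
  ⟨C (A i j), 1, fun z _ => by simp⟩

theorem add (hF : IsRationalOnDisc F) (hG : IsRationalOnDisc G) :
    IsRationalOnDisc fun z => F z + G z := fun i j =>
  rationalOnDisc.add_mem (hF i j) (hG i j)

theorem mul (hF : IsRationalOnDisc F) (hG : IsRationalOnDisc G) :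
    IsRationalOnDisc fun z => F z * G z := fun i j => by
  have : (fun z => (F z * G z) i j) = ∑ k, (fun z => F z i k) * fun z => G z k j := by
    ext z
    simp [Matrix.mul_apply]
  change (fun z => (F z * G z) i j) ∈ rationalOnDisc
  rw [this]
  exact sum_mem fun k _ => mul_mem (hF i k) (hG k j)

theorem id_smul (hF : IsRationalOnDisc F) : IsRationalOnDisc fun z => z • F z := fun i j => by
  have h := eval_mem_rationalOnDisc X
  simp only [eval_X] at h
  exact rationalOnDisc.mul_mem h (hF i j)

theorem inv (hF : IsRationalOnDisc F) (hu : ∀ z ∈ Metric.ball (0 : ℂ) 1, IsUnit (F z)) :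
    IsRationalOnDisc fun z => (F z)⁻¹ := fun i j => by
  have hdet := inv_mem_rationalOnDisc (det_mem_rationalOnDisc hF) fun z hz =>
    ((Matrix.isUnit_iff_isUnit_det _).mp (hu z hz)).ne_zero
  -- The entries of the adjugate are determinants of matrices with rational entries.
  have hadj : (fun z => ((F z).updateRow j (Pi.single i 1)).det) ∈ rationalOnDisc := by
    refine det_mem_rationalOnDisc fun k l => ?_
    by_cases hk : k = j
    · subst hk
      simp only [Matrix.updateRow_self]
      exact const (Matrix.of fun _ => Pi.single i (1 : ℂ)) k l
    · simpa only [Matrix.updateRow_ne hk] using hF k l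
  obtain ⟨p, q, h⟩ := rationalOnDisc.mul_mem hdet hadj
  refine ⟨p, q, fun z hz => ⟨(h z hz).1, ?_⟩⟩
  rw [← (h z hz).2]
  simp [Matrix.inv_def, Matrix.adjugate_apply]

end IsRationalOnDisc

/-! ### Inner functions under fractional linear maps -/

theorem norm_smul_le_one {N : ℕ} {z : ℂ} (hz : z ∈ Metric.ball (0 : ℂ) 1)
    {W : Matrix (Fin N) (Fin N) ℂ} (hW : ‖W‖ ≤ 1) : ‖z • W‖ ≤ 1 := by
  rw [norm_smul]
  exact mul_le_one₀ (mem_ball_zero_iff.mp hz).le (norm_nonneg _) hW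

namespace IsJUnitary

variable {N : ℕ} {a b c d : Matrix (Fin N) (Fin N) ℂ} (h : IsJUnitary a b c d)
include h

theorem differentiableAt_mobius {W : Matrix (Fin N) (Fin N) ℂ} (hW : ‖W‖ ≤ 1) :
    DifferentiableAt ℂ (mobius a b c d) W := by
  have e : mobius a b c d = fun W => (a * W + b) * Ring.inverse (c * W + d) := by
    ext1 W
    rw [mobius, Matrix.nonsing_inv_eq_ringInverse]
  rw [e]
  have h1 (a b : Matrix (Fin N) (Fin N) ℂ) : DifferentiableAt ℂ (fun W => a * W + b) W :=
    ((differentiableAt_const a).mul differentiableAt_id).add_const b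
  exact (h1 a b).mul ((h1 c d).inverse (h.isUnit hW))

theorem isRationalOnDisc {Φ : ℂ → Matrix (Fin N) (Fin N) ℂ} (hΦ : IsRationalOnDisc Φ)
    (hΦ' : IsInnerOnDisc Φ) : IsRationalOnDisc fun z => mobius a b c d (z • Φ z) := by
  have h1 (a b : Matrix (Fin N) (Fin N) ℂ) : IsRationalOnDisc (fun z => a * z • Φ z + b) :=
    ((IsRationalOnDisc.const a).mul hΦ.id_smul).add (.const b)
  exact (h1 a b).mul <| (h1 c d).inv fun z hz =>
    h.isUnit (norm_smul_le_one hz (hΦ'.contractive z hz))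

theorem isInnerOnDisc {Φ : ℂ → Matrix (Fin N) (Fin N) ℂ} (hΦ : IsInnerOnDisc Φ) :
    IsInnerOnDisc fun z => mobius a b c d (z • Φ z) where
  holomorphic := fun z hz =>
    (h.differentiableAt_mobius (norm_smul_le_one hz (hΦ.contractive z hz))
      ).comp_differentiableWithinAt (f := fun z => z • Φ z) z
      (differentiableWithinAt_id.smul (hΦ.holomorphic z hz))
  contractive := fun z hz => h.norm_mobius_le_one (norm_smul_le_one hz (hΦ.contractive z hz))
  boundary := by
    filter_upwards [hΦ.boundary] with θ ⟨U, hU, hlim⟩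
    set ζ := Complex.exp (θ * Complex.I) with hζ
    have hζ1 : star ζ * ζ = 1 := by
      rw [Complex.star_def, ← Complex.normSq_eq_conj_mul_self, Complex.normSq_eq_norm_sq, hζ,
        Complex.norm_exp_ofReal_mul_I]
      norm_num
    have hstar : star (ζ • U) * (ζ • U) = 1 := by
      rw [star_smul, smul_mul_smul_comm, hζ1, one_smul, Matrix.mem_unitaryGroup_iff'.mp hU]
    have hnorm : ‖ζ • U‖ ≤ 1 := by
      open scoped MatrixOrder ComplexOrder in
      rw [norm_le_iff_star_mul_self_le _ zero_le_one, hstar, one_pow, map_one]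
    refine ⟨_, h.mobius_mem_unitaryGroup hnorm hstar, ?_⟩
    refine (h.differentiableAt_mobius hnorm).continuousAt.tendsto.comp (Tendsto.smul ?_ hlim)
    have : ContinuousAt (fun r : ℝ => (r : ℂ) * ζ) 1 := by fun_prop
    simpa using this.tendsto.mono_left nhdsWithin_le_nhds

end IsJUnitary

theorem isInnerOnDisc_one {N : ℕ} : IsInnerOnDisc fun _ : ℂ => (1 : Matrix (Fin N) (Fin N) ℂ) where
  holomorphic := differentiableOn_const _
  contractive := fun z _ => by
    open scoped MatrixOrder ComplexOrder in
    simp [norm_le_iff_star_mul_self_le _ zero_le_one]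
  boundary := .of_forall fun θ => ⟨1, one_mem _, tendsto_const_nhds⟩

/-! ### The Schur algorithm -/

/-- A function bounded by some `r < 1` on the disc agrees at the origin, to any prescribed order,
with a rational inner function. -/
theorem exists_rational_inner_sub_eq_pow_smul {N : ℕ} (n : ℕ)
    {F : ℂ → Matrix (Fin N) (Fin N) ℂ} (hF : DifferentiableOn ℂ F (Metric.ball 0 1)) {r : ℝ}
    (hr : r < 1) (hFr : ∀ z ∈ Metric.ball (0 : ℂ) 1, ‖F z‖ ≤ r) :
    ∃ Φ H : ℂ → Matrix (Fin N) (Fin N) ℂ, IsRationalOnDisc Φ ∧ IsInnerOnDisc Φ ∧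
      DifferentiableOn ℂ H (Metric.ball 0 1) ∧
      ∀ z ∈ Metric.ball (0 : ℂ) 1, F z - Φ z = z ^ n • H z := by
  induction n generalizing F r with
  | zero =>
    exact ⟨fun _ => 1, fun z => F z - 1, .const 1, isInnerOnDisc_one, hF.sub_const 1,
      fun z _ => by simp⟩
  | succ n ih =>
    have h00 : (0 : ℂ) ∈ Metric.ball (0 : ℂ) 1 := by simp
    have hr0 : 0 ≤ r := (norm_nonneg _).trans (hFr 0 h00)
    obtain ⟨a, b, c, d, h, hac⟩ := exists_isJUnitary ((hFr 0 h00).trans_lt hr)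
    -- `G` is the image of `F` under the inverse map, so that `G 0 = 0` and `F = mobius a b c d ∘ G`.
    set G : ℂ → Matrix (Fin N) (Fin N) ℂ :=
      fun z => mobius (star a) (-star c) (-star b) (star d) (F z) with hGdef
    obtain ⟨s, hs0, hs1, hs⟩ := h.symm.exists_norm_mobius_le hr0 hr
    have hF1 : ∀ z ∈ Metric.ball (0 : ℂ) 1, ‖F z‖ ≤ 1 := fun z hz => (hFr z hz).trans hr.le
    have hGs : ∀ z ∈ Metric.ball (0 : ℂ) 1, ‖G z‖ ≤ s := fun z hz => hs _ (hFr z hz)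
    have hG : DifferentiableOn ℂ G (Metric.ball 0 1) := fun z hz =>
      (h.symm.differentiableAt_mobius (hF1 z hz)).comp_differentiableWithinAt z (hF z hz)
    have hG0 : G 0 = 0 := by
      simp [hGdef, mobius, hac]
    have hGz : ∀ z, z • dslope G 0 z = G z := fun z => by
      simpa [hG0] using sub_smul_dslope G 0 z
    have hF1' : DifferentiableOn ℂ (dslope G 0) (Metric.ball 0 1) :=
      (Complex.differentiableOn_dslope (Metric.ball_mem_nhds 0 one_pos)).mpr hG
    have hF1s : ∀ z ∈ Metric.ball (0 : ℂ) 1, ‖dslope G 0 z‖ ≤ s := fun z hz => by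
      have := Complex.norm_dslope_le_div_of_mapsTo_ball (R₂ := s) hG
        (fun w hw => by simpa [hG0] using hGs w hw) hz
      simpa using this
    obtain ⟨Φ, H, hΦ, hΦ', hH, hHz⟩ := ih hF1' hs1 hF1s
    have hΨ := h.isInnerOnDisc hΦ'
    refine ⟨fun z => mobius a b c d (z • Φ z),
      fun z => (a - mobius a b c d (z • Φ z) * c) * H z * (c * G z + d)⁻¹,
      h.isRationalOnDisc hΦ hΦ', hΨ, ?_, fun z hz => ?_⟩
    · simp_rw [Matrix.nonsing_inv_eq_ringInverse]
      refine (((hΨ.holomorphic.mul_const c).const_sub a).mul hH).mul ?_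
      exact ((hG.const_mul c).add_const d).inverse fun z hz => h.isUnit ((hGs z hz).trans hs1.le)
    · have hGz1 := (hGs z hz).trans hs1.le
      calc _ = mobius a b c d (G z) - mobius a b c d (z • Φ z) := by
            rw [hGdef, h.mobius_mobius_symm (hF1 z hz)]
        _ = _ := by
          rw [h.mobius_sub_mobius hGz1 (norm_smul_le_one hz (hΦ'.contractive z hz)), ← hGz z,
            ← smul_sub, hHz z hz, smul_smul, ← pow_succ', hGz z]
          simp

theorem norm_le_mul_pow_of_eq_pow_smul {E : Type*} [NormedAddCommGroup E] [NormedSpace ℂ E] {f H : ℂ → E}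
    {n : ℕ} {M : ℝ} (hf : DifferentiableOn ℂ f (Metric.ball 0 1))
    (hM : ∀ z ∈ Metric.ball (0 : ℂ) 1, ‖f z‖ ≤ M) (hH : DifferentiableOn ℂ H (Metric.ball 0 1))
    (hfH : ∀ z ∈ Metric.ball (0 : ℂ) 1, f z = z ^ (n + 1) • H z) {z : ℂ}
    (hz : z ∈ Metric.ball (0 : ℂ) 1) : ‖f z‖ ≤ M * ‖z‖ ^ (n + 1) := by
  have h00 : (0 : ℂ) ∈ Metric.ball (0 : ℂ) 1 := by simp
  have hf0 : f 0 = 0 := by simp [hfH 0 h00]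
  have hnhds := Metric.ball_mem_nhds (0 : ℂ) one_pos
  have ho : (f · - f 0) =o[𝓝 0] (fun w : ℂ ↦ ‖w - 0‖ ^ n) := by
    have hH0 : H =O[𝓝 0] (fun _ => (1 : ℝ)) :=
      (hH.continuousOn.continuousAt hnhds).isBigO_one ℝ
    have h1 : (fun w : ℂ => w ^ (n + 1)) =o[𝓝 0] fun w => ‖w‖ ^ n := by
      have := (Asymptotics.isLittleO_pow_pow (𝕜 := ℂ) n.lt_succ_self)
      simpa using this.norm_right
    refine (h1.smul_isBigO hH0).congr' ?_ ?_
    · filter_upwards [hnhds] with w hw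
      rw [hfH w hw, hf0, sub_zero]
    · exact .of_forall fun w => by simp
  simpa [hf0] using Complex.dist_le_mul_div_pow_of_mapsTo_ball_of_isLittleO hf
    (fun w hw => by simpa [hf0] using hM w hw) ho hz

theorem theorem2p4 (N : ℕ) (F : ℂ → Matrix (Fin N) (Fin N) ℂ)
    (hF : DifferentiableOn ℂ F (Metric.ball 0 1))
    (hF1 : ∀ z ∈ Metric.ball (0 : ℂ) 1, ‖F z‖ ≤ 1) :
    ∃ Φ : ℕ → ℂ → Matrix (Fin N) (Fin N) ℂ,
      (∀ m, IsRationalOnDisc (Φ m) ∧ IsInnerOnDisc (Φ m)) ∧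
      ∀ K ⊆ Metric.ball (0 : ℂ) 1, IsCompact K → TendstoUniformlyOn Φ F atTop K := by
  -- The factor `1 - ε m` makes the function a strict contraction, uniformly on the disc.
  set ε : ℕ → ℝ := fun m => 1 / ((m : ℝ) + 1) with hε
  have hε0 (m : ℕ) : 0 < ε m := Nat.one_div_pos_of_nat
  have hε1 (m : ℕ) : ε m ≤ 1 := by
    rw [hε]; exact div_le_one_of_le₀ (by linarith [(m.cast_nonneg : (0 : ℝ) ≤ m)]) (by positivity)
  have hscale (m : ℕ) (z) (hz : z ∈ Metric.ball (0 : ℂ) 1) :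
      ‖((1 - ε m : ℝ) : ℂ) • F z‖ ≤ 1 - ε m := by
    rw [norm_smul, Complex.norm_real, Real.norm_of_nonneg (sub_nonneg.mpr (hε1 m))]
    exact mul_le_of_le_one_right (sub_nonneg.mpr (hε1 m)) (hF1 z hz)
  choose Φ H hΦ hΦ' hH hHz using fun m : ℕ => exists_rational_inner_sub_eq_pow_smul (m + 1)
    (hF.const_smul ((1 - ε m : ℝ) : ℂ)) (sub_lt_self 1 (hε0 m)) (hscale m)
  have hbound (m : ℕ) (z) (hz : z ∈ Metric.ball (0 : ℂ) 1) :
      ‖F z - Φ m z‖ ≤ ε m + 2 * ‖z‖ ^ (m + 1) := by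
    have h1 := norm_le_mul_pow_of_eq_pow_smul (f := fun z => ((1 - ε m : ℝ) : ℂ) • F z - Φ m z) (M := 2)
      (DifferentiableOn.fun_sub (hF.fun_const_smul _) (hΦ' m).holomorphic) (fun w hw => ?_) (hH m) (hHz m) hz
    · have h2 : F z - Φ m z = (ε m : ℂ) • F z + (((1 - ε m : ℝ) : ℂ) • F z - Φ m z) := by
        push_cast
        module
      rw [h2]
      refine (norm_add_le _ _).trans (add_le_add ?_ h1)
      rw [norm_smul, Complex.norm_real, Real.norm_of_nonneg (hε0 m).le]
      exact mul_le_of_le_one_right (hε0 m).le (hF1 z hz)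
    · have := norm_sub_le (((1 - ε m : ℝ) : ℂ) • F w) (Φ m w)
      linarith [hscale m w hw, (hΦ' m).contractive w hw, hε0 m]
  refine ⟨Φ, fun m => ⟨hΦ m, hΦ' m⟩, fun K hK hKc => ?_⟩
  obtain ⟨ρ, hρ0, hρ1, hρ⟩ : ∃ ρ : ℝ, 0 ≤ ρ ∧ ρ < 1 ∧ ∀ z ∈ K, ‖z‖ ≤ ρ := by
    rcases K.eq_empty_or_nonempty with rfl | hne
    · exact ⟨0, le_rfl, one_pos, by simp⟩
    · obtain ⟨w, hw, hmax⟩ := hKc.exists_isMaxOn hne continuous_norm.continuousOn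
      exact ⟨‖w‖, norm_nonneg w, mem_ball_zero_iff.mp (hK hw), fun z hz => hmax hz⟩
  have hlim : Tendsto (fun m => ε m + 2 * ρ ^ (m + 1)) atTop (𝓝 0) := by
    have := (tendsto_one_div_add_atTop_nhds_zero_nat (𝕜 := ℝ)).add
      (((tendsto_pow_atTop_nhds_zero_of_lt_one hρ0 hρ1).comp (tendsto_add_atTop_nat 1)).const_mul 2)
    simpa [hε] using this
  rw [Metric.tendstoUniformlyOn_iff]
  intro δ hδ
  filter_upwards [hlim.eventually_lt_const hδ] with m hm z hz
  rw [dist_eq_norm]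
  refine ((hbound m z (hK hz)).trans ?_).trans_lt hm
  gcongr
  exact hρ z hz
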